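/- Let $(\Omega,\mathcal F,\mathbb P)$ be an atomless probability space, $\mathcal X=L^\infty(\Omega,\mathcal F,\mathbb P)$, and let $X_1,\dots,X_n\in\mathcal X$ be initial endowments with aggregate $S=\sum_{i=1}^n X_i$. Let $\mathcal A=\{(Y_i)_{i=1}^n\in\mathcal X^n:\sum_{i=1}^n Y_i=S\}$ be the set of allocations, and let $\mathcal A_C\subseteq\mathcal A$ be the set of comonotone allocations, i.e. those $(Y_i)$ having versions with $[Y_i(\omega_1)-Y_i(\omega_2)]\,[Y_j(\omega_1)-Y_j(\omega_2)]\ge 0$ for all $\omega_1,\omega_2\in\Omega$ and all $i,j$. For each $i$ let $U_i:\mathcal X\to\mathbb R$ be a utility functional such that - $U_i$ is concave; - $U_i$ is S.S.D. preserving: $U_i(Z_1)\le U_i(Z_2)$ whenever $Z_1,Z_2\in\mathcal X$ satisfy $\mathbb E[\phi(Z_1)]\le\mathbb E[\phi(Z_2)]$ for every nondecreasing concave $\phi:\mathbb R\to\mathbb R$ for which these expectations are defined; - for every $Z\in\mathcal X$ the function $c\mapsto U_i(Z+c)$ on $\mathbb R$ is continuous, strictly increasing, and tends to $\infty$ as $c\to\infty$.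 Let $\mathcal{IR}=\{(Y_i)\in\mathcal A: U_i(Y_i)\ge U_i(X_i)\ \forall i\}$ be the set of individually rational allocations. Let $\mathcal{PO}$ be the set of $(Y_i^*)\in\mathcal{IR}$ for which there is no $(Y_i)\in\mathcal{IR}$ with $U_i(Y_i)\ge U_i(Y_i^*)$ for all $i$ and strict inequality for at least one $i$. Let $\mathcal{CPO}$ be the set of $(Y_i^*)\in\mathcal{IR}\cap\mathcal A_C$ for which there is no such $(Y_i)$ in $\mathcal{IR}\cap\mathcal A_C$. Then $\mathcal{PO}\neq\varnothing$ if and only if $\mathcal{CPO}\neq\varnothing$. Furthermore, when both sets are nonempty, for every $\lambda\in\mathbb R_+^n\setminus\{0\}$, $$\sup_{(Y_i)\in\mathcal{IR}}\ \sum_{i=1}^n\lambda_i\,U_i(Y_i)\;=\;\sup_{(Y_i)\in\mathcal{IR}\cap\mathcal A_C}\ \sum_{i=1}^n\lambda_i\,U_i(Y_i),$$ as an equality in $(-\infty,+\infty]$. -/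

import Mathlib

open MeasureTheory Filter
open scoped ENNReal BigOperators

noncomputable section

namespace RiskSharing

variable {Ω : Type*} [MeasurableSpace Ω]

/-- A measure is atomless if every measurable set of positive measure contains a measurable
subset of strictly smaller positive measure. -/
def Atomless (μ : Measure Ω) : Prop :=
  ∀ A : Set Ω, MeasurableSet A → 0 < μ A →
    ∃ B : Set Ω, B ⊆ A ∧ MeasurableSet B ∧ 0 < μ B ∧ μ B < μ A

/-- The space `L^∞(μ)` of essentially bounded real random variables (up to a.s. equality). -/
abbrev LInfty (μ : Measure Ω) : Type _ := Lp ℝ (⊤ : ℝ≥0∞) μ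

/-- `ICVLe μ Z₁ Z₂`: `Z₂` dominates `Z₁` in the increasing concave order. -/
def ICVLe (μ : Measure Ω) (Z₁ Z₂ : LInfty μ) : Prop :=
  ∀ φ : ℝ → ℝ, Monotone φ → ConcaveOn ℝ Set.univ φ →
    Integrable (fun ω => φ (Z₁ ω)) μ → Integrable (fun ω => φ (Z₂ ω)) μ →
      ∫ ω, φ (Z₁ ω) ∂μ ≤ ∫ ω, φ (Z₂ ω) ∂μ

/-- `U` is S.S.D. preserving: consistent with the increasing concave order. -/
def SSDPreserving (μ : Measure Ω) (U : LInfty μ → ℝ) : Prop :=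
  ∀ Z₁ Z₂ : LInfty μ, ICVLe μ Z₁ Z₂ → U Z₁ ≤ U Z₂

/-- For every `Z`, the function `c ↦ U (Z + c)` is continuous, strictly increasing and tends
to `∞` as `c → ∞`. -/
def IncreasingInCash (μ : Measure Ω) [IsFiniteMeasure μ] (U : LInfty μ → ℝ) : Prop :=
  ∀ Z : LInfty μ,
    Continuous (fun c : ℝ => U (Z + Lp.const (⊤ : ℝ≥0∞) μ c)) ∧
    StrictMono (fun c : ℝ => U (Z + Lp.const (⊤ : ℝ≥0∞) μ c)) ∧
    Tendsto (fun c : ℝ => U (Z + Lp.const (⊤ : ℝ≥0∞) μ c)) atTop atTop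

variable {μ : Measure Ω} {n : ℕ}

/-- Allocations of the aggregate endowment `∑ i, X i`. -/
def allocations (X : Fin n → LInfty μ) : Set (Fin n → LInfty μ) :=
  {Y | ∑ i, Y i = ∑ i, X i}

/-- A vector of elements of `L^∞` is comonotone if its components have versions that are
comonotone random variables: any two of them never move in opposite directions. -/
def Comonotone (Y : Fin n → LInfty μ) : Prop :=
  ∃ Z : Fin n → Ω → ℝ, (∀ i, Measurable (Z i)) ∧ (∀ i, Y i =ᵐ[μ] Z i) ∧
    ∀ (ω₁ ω₂ : Ω) (i j : Fin n), 0 ≤ (Z i ω₁ - Z i ω₂) * (Z j ω₁ - Z j ω₂)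

/-- Comonotone allocations. -/
def comonotoneAllocations (X : Fin n → LInfty μ) : Set (Fin n → LInfty μ) :=
  {Y | Y ∈ allocations X ∧ Comonotone Y}

/-- Individually rational allocations. -/
def IR (U : Fin n → LInfty μ → ℝ) (X : Fin n → LInfty μ) : Set (Fin n → LInfty μ) :=
  {Y | Y ∈ allocations X ∧ ∀ i, U i (X i) ≤ U i (Y i)}

/-- `Y` Pareto dominates `Y'`. -/
def Dominates (U : Fin n → LInfty μ → ℝ) (Y Y' : Fin n → LInfty μ) : Prop :=
  (∀ i, U i (Y' i) ≤ U i (Y i)) ∧ ∃ i, U i (Y' i) < U i (Y i)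

/-- Pareto-optimal allocations. -/
def PO (U : Fin n → LInfty μ → ℝ) (X : Fin n → LInfty μ) : Set (Fin n → LInfty μ) :=
  {Y | Y ∈ IR U X ∧ ¬ ∃ Y' ∈ IR U X, Dominates U Y' Y}

/-- Comonotone Pareto-optimal allocations. -/
def CPO (U : Fin n → LInfty μ → ℝ) (X : Fin n → LInfty μ) : Set (Fin n → LInfty μ) :=
  {Y | Y ∈ IR U X ∩ comonotoneAllocations X ∧
    ¬ ∃ Y' ∈ IR U X ∩ comonotoneAllocations X, Dominates U Y' Y}

/-- Weight vectors: nonnegative and nonzero. -/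
def weights (n : ℕ) : Set (Fin n → ℝ) :=
  {l | ∀ i, 0 ≤ l i} \ {0}

/-- The supremum, in the extended reals, of the `l`-weighted sum of utilities over a set of
allocations. -/
def weightedSup (U : Fin n → LInfty μ → ℝ) (l : Fin n → ℝ) (C : Set (Fin n → LInfty μ)) :
    EReal :=
  ⨆ Y ∈ C, ((∑ i, l i * U i (Y i) : ℝ) : EReal)

end RiskSharing

end

/-! The heart is comonotone improvement: every allocation `Y` is dominated, component by component
in the concave order, by a comonotone redistribution of the same aggregate. The redistributions
dominating `Y` form a closed convex set in a Hilbert space of `L²` vectors, so one of them, `Z`, has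
least norm. Were `Z` not comonotone, two of its components would move in opposite directions: the
first lies above a level `c` and the second below a level `d` with positive probability, and the
reverse also happens with positive probability. Exchanging a suitable amount between them moves the
first toward `c` and the second toward `d` without changing their means; this improves both in the
concave order and lowers the norm, a contradiction. Utilities that respect the order do not decrease
in passing from `Y` to `Z`, so the restriction to comonotone allocations affects neither the
existence of Pareto optima nor the weighted suprema. -/

namespace RiskSharing

section Real

lemma exists_subgradient {S : Set ℝ} {φ : ℝ → ℝ} (hφ : ConvexOn ℝ S φ) {c : ℝ}
    (hc : c ∈ interior S) : ∃ p, ∀ x ∈ S, φ c + p * (x - c) ≤ φ x := by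
  refine ⟨derivWithin φ (Set.Ioi c) c, fun x hx => ?_⟩
  rcases lt_trichotomy x c with hxc | rfl | hcx
  · have h := (hφ.slope_le_leftDeriv_of_mem_interior hx hc hxc).trans
      (hφ.leftDeriv_le_rightDeriv_of_mem_interior hc)
    rw [slope_def_field, div_le_iff₀ (sub_pos.2 hxc)] at h
    linarith
  · simp
  · have h := hφ.rightDeriv_le_slope_of_mem_interior hc hx hcx
    rw [slope_def_field, le_div_iff₀ (sub_pos.2 hcx)] at h
    linarith

lemma exists_slope_le_sub_of_mem_uIcc {φ : ℝ → ℝ} (hφ : ConcaveOn ℝ Set.univ φ) (c : ℝ) :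
    ∃ p, ∀ x, ∀ y ∈ Set.uIcc x c, p * (y - x) ≤ φ y - φ x := by
  obtain ⟨p, hp⟩ := exists_subgradient hφ.neg (c := c) (by simp)
  refine ⟨-p, fun x y hy => ?_⟩
  rw [← segment_eq_uIcc] at hy
  obtain ⟨a, b, ha, hb, hab, rfl⟩ := hy
  have hchord : a * φ x + b * φ c ≤ φ (a • x + b • c) := hφ.2 trivial trivial ha hb hab
  have hsupport : b * (-φ c + p * (x - c)) ≤ b * -φ x :=
    mul_le_mul_of_nonneg_left (hp x trivial) hb
  obtain rfl : a = 1 - b := by linarith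
  simp only [smul_eq_mul] at hchord ⊢
  linarith

/-- The common part `min (x - c) (d - y)` of the excess of `x` over `c` and the shortfall of `y`
below `d`, or `0` if one of them is negative: the amount that can be moved from `x` to `y` without
pushing `x` below `c` or `y` above `d`. -/
def transferable (c d x y : ℝ) : ℝ := max 0 (min (x - c) (d - y))

lemma transferable_nonneg (c d x y : ℝ) : 0 ≤ transferable c d x y := le_max_left _ _

lemma transferable_pos_iff {c d x y : ℝ} : 0 < transferable c d x y ↔ c < x ∧ y < d := by
  simp [transferable]

lemma transferable_eq_zero_or (c d x y : ℝ) :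
    transferable c d x y = 0 ∨ transferable d c y x = 0 := by
  by_contra! h
  have h₁ := transferable_pos_iff.1 ((transferable_nonneg _ _ _ _).lt_of_ne' h.1)
  have h₂ := transferable_pos_iff.1 ((transferable_nonneg _ _ _ _).lt_of_ne' h.2)
  exact lt_asymm h₁.1 h₂.2

lemma transferable_le_abs (c d x y : ℝ) : transferable c d x y ≤ |x - c| :=
  max_le (abs_nonneg _) ((min_le_left _ _).trans (le_abs_self _))

lemma add_transferable_sub_mem_uIcc (c d x y : ℝ) {s t : ℝ} (hs : s ∈ Set.Icc (0 : ℝ) 1)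
    (ht : t ∈ Set.Icc (0 : ℝ) 1) :
    x + (t * transferable d c y x - s * transferable c d x y) ∈ Set.uIcc x c := by
  have hdown := transferable_nonneg c d x y
  have hup := transferable_nonneg d c y x
  have hs' := mul_le_of_le_one_left hdown hs.2
  have ht' := mul_le_of_le_one_left hup ht.2
  have hs₀ := mul_nonneg hs.1 hdown
  have ht₀ := mul_nonneg ht.1 hup
  rw [Set.mem_uIcc]
  rcases transferable_eq_zero_or c d x y with h | h
  · rcases hup.eq_or_lt with h' | h'
    · rcases le_total x c with hxc | hxc <;> simp [h, ← h', hxc]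
    · have hle : transferable d c y x ≤ c - x :=
        max_le (sub_nonneg.2 (transferable_pos_iff.1 h').2.le) (min_le_right _ _)
      left
      rw [h]
      constructor <;> linarith
  · rcases hdown.eq_or_lt with h' | h'
    · rcases le_total x c with hxc | hxc <;> simp [h, ← h', hxc]
    · have hle : transferable c d x y ≤ x - c :=
        max_le (sub_nonneg.2 (transferable_pos_iff.1 h').1.le) (min_le_left _ _)
      right
      rw [h]
      constructor <;> linarith

lemma exists_balancing_weights {A B : ℝ} (hA : 0 < A) (hB : 0 < B) :
    ∃ s ∈ Set.Ioc (0 : ℝ) 1, ∃ t ∈ Set.Icc (0 : ℝ) 1, t * B = s * A :=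
  ⟨B / (A + B), ⟨by positivity, (div_le_one (by positivity)).2 (by linarith)⟩,
    A / (A + B), ⟨by positivity, (div_le_one (by positivity)).2 (by linarith)⟩, by ring⟩

end Real

section ConcaveOrder

variable {Ω : Type*} [MeasurableSpace Ω] {μ : Measure Ω}

/-- The concave stochastic order: `g` dominates `f`. As the test functions need not be monotone,
dominating also entails having the same mean. Integrals of non-integrable functions are `0` here,
which is harmless when `f` is bounded: an integrable `g` dominating it is then bounded as well. -/
def ConcaveLE (μ : Measure Ω) (f g : Ω → ℝ) : Prop :=
  ∀ φ : ℝ → ℝ, ConcaveOn ℝ Set.univ φ → ∫ ω, φ (f ω) ∂μ ≤ ∫ ω, φ (g ω) ∂μ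

/-- `g` arises from `f` by moving every value some part of the way toward one common level, in such
a way that the mean is preserved. -/
structure IsLevelContraction (μ : Measure Ω) (f g : Ω → ℝ) : Prop where
  integral_eq : ∫ ω, g ω ∂μ = ∫ ω, f ω ∂μ
  exists_mem_uIcc : ∃ c, ∀ᵐ ω ∂μ, g ω ∈ Set.uIcc (f ω) c

lemma IsLevelContraction.refl (f : Ω → ℝ) : IsLevelContraction μ f f :=
  ⟨rfl, 0, Eventually.of_forall fun _ => Set.left_mem_uIcc⟩

lemma ConcaveLE.trans {f g h : Ω → ℝ} (hfg : ConcaveLE μ f g) (hgh : ConcaveLE μ g h) :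
    ConcaveLE μ f h :=
  fun φ hφ => (hfg φ hφ).trans (hgh φ hφ)

lemma concaveLE_of_ae_eq {f g : Ω → ℝ} (h : f =ᵐ[μ] g) : ConcaveLE μ f g :=
  fun φ _ => (integral_congr_ae (h.fun_comp φ)).le

lemma ConcaveLE.icvLe {Z₁ Z₂ : LInfty μ} (h : ConcaveLE μ Z₁ Z₂) : ICVLe μ Z₁ Z₂ :=
  fun φ _ hφ _ _ => h φ hφ

lemma memLp_top_comp_of_continuous {φ : ℝ → ℝ} (hφ : Continuous φ) {f : Ω → ℝ}
    (hf : MemLp f ⊤ μ) : MemLp (fun ω => φ (f ω)) ⊤ μ := by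
  obtain ⟨C, hC⟩ := (isCompact_closedBall (0 : ℝ) (lpNorm f ⊤ μ)).exists_bound_of_continuousOn
    hφ.continuousOn
  refine memLp_top_of_bound (hφ.comp_aestronglyMeasurable hf.1) C ?_
  filter_upwards [ae_le_lpNorm_exponent_top hf] with ω h
  exact hC _ (mem_closedBall_zero_iff.2 h)

variable [IsFiniteMeasure μ]

lemma integrable_concave_comp {φ : ℝ → ℝ} (hφ : ConcaveOn ℝ Set.univ φ) {f : Ω → ℝ}
    (hf : MemLp f ⊤ μ) : Integrable (fun ω => φ (f ω)) μ :=
  (memLp_top_comp_of_continuous hφ.locallyLipschitz.continuous hf).integrable le_top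

lemma ConcaveLE.ae_abs_le {f g : Ω → ℝ} (h : ConcaveLE μ f g) (hg : Integrable g μ) {M : ℝ}
    (hf : ∀ᵐ ω ∂μ, |f ω| ≤ M) : ∀ᵐ ω ∂μ, |g ω| ≤ M := by
  -- This test function vanishes exactly on `[-M, M]` and is negative elsewhere.
  have hφ : ConcaveOn ℝ Set.univ fun x : ℝ => min (M - |x|) 0 :=
    ((concaveOn_const M convex_univ).sub (convexOn_norm convex_univ)).inf
      (concaveOn_const 0 convex_univ)
  have hint : Integrable (fun ω => -min (M - |g ω|) 0) μ :=
    (((integrable_const M).sub hg.abs).inf (integrable_const 0)).neg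
  have hf₀ : ∫ ω, min (M - |f ω|) 0 ∂μ = 0 :=
    integral_eq_zero_of_ae (hf.mono fun ω hω => min_eq_right (sub_nonneg.2 hω))
  have hpos : 0 ≤ fun ω => -min (M - |g ω|) 0 := fun ω => neg_nonneg.2 (min_le_right _ _)
  have hg₀ : ∫ ω, -min (M - |g ω|) 0 ∂μ = 0 := by
    refine le_antisymm ?_ (integral_nonneg hpos)
    rw [integral_neg]
    linarith [h _ hφ]
  filter_upwards [(integral_eq_zero_iff_of_nonneg hpos hint).1 hg₀] with ω hω
  exact sub_nonneg.1 (min_eq_right_iff.1 (neg_eq_zero.1 hω))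

lemma ConcaveLE.memLp_top {f g : Ω → ℝ} (h : ConcaveLE μ f g) (hf : MemLp f ⊤ μ)
    (hg : Integrable g μ) : MemLp g ⊤ μ :=
  memLp_top_of_bound hg.1 _ (h.ae_abs_le hg (ae_le_lpNorm_exponent_top hf))

lemma memLp_of_mem_uIcc {p : ℝ≥0∞} {f g : Ω → ℝ} {c : ℝ} (hf : MemLp f p μ)
    (hg : AEStronglyMeasurable g μ) (hmem : ∀ᵐ ω ∂μ, g ω ∈ Set.uIcc (f ω) c) : MemLp g p μ := by
  have hsub : MemLp (fun ω => g ω - c) p μ :=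
    (hf.sub (memLp_const c)).mono (hg.sub aestronglyMeasurable_const)
      (hmem.mono fun ω hω => Set.abs_sub_left_of_mem_uIcc (Set.uIcc_comm (f ω) c ▸ hω))
  exact (hsub.add (memLp_const c)).ae_eq (Eventually.of_forall fun ω => sub_add_cancel _ _)

lemma IsLevelContraction.concaveLE {f g : Ω → ℝ} (h : IsLevelContraction μ f g)
    (hf : MemLp f ⊤ μ) (hg_meas : AEStronglyMeasurable g μ) : ConcaveLE μ f g := by
  obtain ⟨hmean, c, hmem⟩ := h
  intro φ hφ
  obtain ⟨p, hp⟩ := exists_slope_le_sub_of_mem_uIcc hφ c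
  have hg := memLp_of_mem_uIcc hf hg_meas hmem
  have hfi := hf.integrable le_top
  have hgi := hg.integrable le_top
  have hφf := integrable_concave_comp hφ hf
  have hφg := integrable_concave_comp hφ hg
  refine sub_nonneg.1 ?_
  calc (0 : ℝ) = ∫ ω, p * (g ω - f ω) ∂μ := by
        rw [integral_const_mul, integral_sub hgi hfi, hmean, sub_self, mul_zero]
    _ ≤ ∫ ω, (φ (g ω) - φ (f ω)) ∂μ :=
        integral_mono_ae ((hgi.sub hfi).const_mul p) (hφg.sub hφf)
          (hmem.mono fun ω hω => hp _ _ hω)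
    _ = ∫ ω, φ (g ω) ∂μ - ∫ ω, φ (f ω) ∂μ := integral_sub hφg hφf

variable {p : ℝ≥0∞} [hp : Fact (1 ≤ p)]

lemma convex_setOf_concaveLE {f : Ω → ℝ} (hf : MemLp f ⊤ μ) :
    Convex ℝ {g : Lp ℝ p μ | ConcaveLE μ f g} := by
  intro g hg h hh a b ha hb hab φ hφ
  have hg_top : MemLp g ⊤ μ := hg.memLp_top hf ((Lp.memLp g).integrable hp.out)
  have hh_top : MemLp h ⊤ μ := hh.memLp_top hf ((Lp.memLp h).integrable hp.out)
  have hcoe : ⇑(a • g + b • h) =ᵐ[μ] fun ω => a • g ω + b • h ω := by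
    filter_upwards [Lp.coeFn_add (a • g) (b • h), Lp.coeFn_smul a g, Lp.coeFn_smul b h]
      with ω hadd hag hbh
    rw [hadd, Pi.add_apply, hag, hbh, Pi.smul_apply, Pi.smul_apply]
  have hφg := (integrable_concave_comp hφ hg_top).const_mul a
  have hφh := (integrable_concave_comp hφ hh_top).const_mul b
  calc ∫ ω, φ (f ω) ∂μ = a * ∫ ω, φ (f ω) ∂μ + b * ∫ ω, φ (f ω) ∂μ := by
        rw [← add_mul, hab, one_mul]
    _ ≤ a * ∫ ω, φ (g ω) ∂μ + b * ∫ ω, φ (h ω) ∂μ :=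
        add_le_add (mul_le_mul_of_nonneg_left (hg φ hφ) ha)
          (mul_le_mul_of_nonneg_left (hh φ hφ) hb)
    _ = ∫ ω, (a * φ (g ω) + b * φ (h ω)) ∂μ := by
        rw [integral_add hφg hφh, integral_const_mul, integral_const_mul]
    _ ≤ ∫ ω, φ (a • g ω + b • h ω) ∂μ :=
        integral_mono (hφg.add hφh)
          (integrable_concave_comp hφ ((hg_top.const_smul a).add (hh_top.const_smul b)))
          fun ω => hφ.2 trivial trivial ha hb hab
    _ = ∫ ω, φ ((a • g + b • h : Lp ℝ p μ) ω) ∂μ := integral_congr_ae (hcoe.symm.fun_comp φ)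

lemma isClosed_setOf_concaveLE {f : Ω → ℝ} (hf : MemLp f ⊤ μ) :
    IsClosed {g : Lp ℝ p μ | ConcaveLE μ f g} := by
  refine IsSeqClosed.isClosed fun u g hu hlim φ hφ => ?_
  obtain ⟨k, -, hk⟩ := (tendstoInMeasure_of_tendsto_Lp hlim).exists_seq_tendsto_ae
  have hcont : Continuous φ := hφ.locallyLipschitz.continuous
  obtain ⟨C, hC⟩ := (isCompact_closedBall (0 : ℝ) (lpNorm f ⊤ μ)).exists_bound_of_continuousOn
    hcont.continuousOn
  have hbound : ∀ m, ∀ᵐ ω ∂μ, ‖φ (u (k m) ω)‖ ≤ C := fun m =>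
    ((hu (k m)).ae_abs_le ((Lp.memLp _).integrable hp.out) (ae_le_lpNorm_exponent_top hf)).mono
      fun ω hω => hC _ (mem_closedBall_zero_iff.2 hω)
  have htendsto : Tendsto (fun m => ∫ ω, φ (u (k m) ω) ∂μ) atTop (nhds (∫ ω, φ (g ω) ∂μ)) :=
    tendsto_integral_of_dominated_convergence (fun _ => C)
      (fun m => hcont.comp_aestronglyMeasurable (Lp.aestronglyMeasurable _))
      (integrable_const C) hbound (hk.mono fun ω hω => (hcont.tendsto _).comp hω)
  exact ge_of_tendsto' htendsto fun m => hu (k m) φ hφ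

lemma IsLevelContraction.norm_sq_add_norm_sub_sq_le {f g : Lp ℝ 2 μ}
    (h : IsLevelContraction μ f g) : ‖g‖ ^ 2 + ‖g - f‖ ^ 2 ≤ ‖f‖ ^ 2 := by
  obtain ⟨hmean, c, hmem⟩ := h
  have hgi : Integrable g μ := (Lp.memLp g).integrable one_le_two
  have hfi : Integrable f μ := (Lp.memLp f).integrable one_le_two
  have hinner : inner ℝ g (g - f) ≤ 0 := by
    calc inner ℝ g (g - f) = ∫ ω, inner ℝ (g ω) ((g - f) ω) ∂μ := L2.inner_def _ _
      _ ≤ ∫ ω, c * (g ω - f ω) ∂μ := by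
        refine integral_mono_ae (L2.integrable_inner _ _) ((hgi.sub hfi).const_mul c) ?_
        filter_upwards [hmem, Lp.coeFn_sub g f] with ω hω hsub
        rw [hsub, Pi.sub_apply, RCLike.inner_apply, conj_trivial]
        rcases Set.mem_uIcc.1 hω with ⟨h₁, h₂⟩ | ⟨h₁, h₂⟩ <;> nlinarith
      _ = 0 := by
        rw [integral_const_mul, integral_sub hgi hfi, hmean, sub_self, mul_zero]
  have hexpand := norm_sub_sq_real g (g - f)
  rw [sub_sub_cancel] at hexpand
  linarith

end ConcaveOrder

section Versions

variable {Ω : Type*} [MeasurableSpace Ω] {μ : Measure Ω}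

lemma exists_mem_ae_monovaryOn {f g : Ω → ℝ}
    (h : ∀ c d : ℝ, (∃ᵐ ω ∂μ, c < f ω ∧ g ω < d) → ¬ ∃ᵐ ω ∂μ, d < g ω ∧ f ω < c) :
    ∃ G ∈ ae μ, MonovaryOn f g G := by
  have hlevel : ∀ c d : ℚ, ∃ G ∈ ae μ,
      (∀ ω ∈ G, ¬ (c < f ω ∧ g ω < d)) ∨ ∀ ω ∈ G, ¬ (d < g ω ∧ f ω < c) := fun c d => by
    by_cases hcd : ∃ᵐ ω ∂μ, c < f ω ∧ g ω < d
    · exact ⟨_, not_frequently.1 (h c d hcd), Or.inr fun ω hω => hω⟩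
    · exact ⟨_, not_frequently.1 hcd, Or.inl fun ω hω => hω⟩
  choose G hG hGlevel using hlevel
  refine ⟨⋂ c, ⋂ d, G c d,
    countable_iInter_mem.2 fun c => countable_iInter_mem.2 fun d => hG c d, ?_⟩
  intro ω₁ h₁ ω₂ h₂ hg
  by_contra! hf
  obtain ⟨c, hc₂, hc₁⟩ := exists_rat_btwn hf
  obtain ⟨d, hd₁, hd₂⟩ := exists_rat_btwn hg
  simp only [Set.mem_iInter] at h₁ h₂
  rcases hGlevel c d with hno | hno
  · exact hno ω₁ (h₁ c d) ⟨hc₁, hd₁⟩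
  · exact hno ω₂ (h₂ c d) ⟨hd₂, hc₂⟩

lemma exists_measurable_monovary_versions {ι : Type*} [Countable ι] {f : ι → Ω → ℝ}
    (hf : ∀ i, Measurable (f i)) (h : ∀ i j, ∃ G ∈ ae μ, MonovaryOn (f i) (f j) G) :
    ∃ Z : ι → Ω → ℝ, (∀ i, Measurable (Z i)) ∧ (∀ i, f i =ᵐ[μ] Z i) ∧
      ∀ i j, Monovary (Z i) (Z j) := by
  classical
  choose E hE hmono using h
  obtain ⟨G, hG, hGmeas, hGE⟩ : ∃ G ∈ ae μ, MeasurableSet G ∧ G ⊆ ⋂ i, ⋂ j, E i j :=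
    IsMeasurablyGenerated.exists_measurable_subset
      (countable_iInter_mem.2 fun i => countable_iInter_mem.2 fun j => hE i j)
  rcases G.eq_empty_or_nonempty with rfl | ⟨ω₀, hω₀⟩
  · exact ⟨0, fun _ => measurable_const, fun _ => mem_of_superset hG (Set.empty_subset _),
      fun _ _ => monovary_self _⟩
  let π : Ω → Ω := G.piecewise id fun _ => ω₀
  have hπ : Measurable π := measurable_id.piecewise hGmeas measurable_const
  have hπG : ∀ ω, π ω ∈ G := fun ω => by
    by_cases hω : ω ∈ G <;> simp [π, hω, hω₀]
  refine ⟨fun i => f i ∘ π, fun i => (hf i).comp hπ, fun i => ?_, fun i j ω₁ ω₂ => ?_⟩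
  · filter_upwards [hG] with ω hω
    simp [π, hω]
  · have hin : ∀ ω, π ω ∈ E i j := fun ω => Set.mem_iInter₂.1 (hGE (hπG ω)) i j
    exact hmono i j (hin ω₁) (hin ω₂)

end Versions

section Improvement

variable {Ω : Type*} [MeasurableSpace Ω] {μ : Measure Ω}

lemma memLp_transferable [IsFiniteMeasure μ] {p : ℝ≥0∞} {f g : Ω → ℝ} (hf : MemLp f p μ)
    (hg : AEStronglyMeasurable g μ) (c d : ℝ) :
    MemLp (fun ω => transferable c d (f ω) (g ω)) p μ := by
  have hmeas : AEStronglyMeasurable (fun ω => transferable c d (f ω) (g ω)) μ :=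
    aestronglyMeasurable_const.sup
      ((hf.1.sub aestronglyMeasurable_const).inf (aestronglyMeasurable_const.sub hg))
  refine (hf.sub (memLp_const c)).mono hmeas (Eventually.of_forall fun ω => ?_)
  rw [Real.norm_of_nonneg (transferable_nonneg _ _ _ _)]
  exact transferable_le_abs _ _ _ _

lemma integral_transferable_pos {f g : Ω → ℝ} {c d : ℝ}
    (hint : Integrable (fun ω => transferable c d (f ω) (g ω)) μ)
    (h : ∃ᵐ ω ∂μ, c < f ω ∧ g ω < d) : 0 < ∫ ω, transferable c d (f ω) (g ω) ∂μ := by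
  have hnonneg : 0 ≤ fun ω => transferable c d (f ω) (g ω) := fun ω => transferable_nonneg _ _ _ _
  refine (integral_nonneg hnonneg).lt_of_ne' fun hzero => ?_
  obtain ⟨ω, hpos, hω⟩ :=
    (h.and_eventually ((integral_eq_zero_iff_of_nonneg hnonneg hint).1 hzero)).exists
  exact (transferable_pos_iff.2 hpos).ne' hω

variable [IsFiniteMeasure μ]

lemma isLevelContraction_add {p : ℝ≥0∞} [hp : Fact (1 ≤ p)] {f τ : Lp ℝ p μ} {c : ℝ}
    (hmean : ∫ ω, τ ω ∂μ = 0) (hmem : ∀ᵐ ω ∂μ, f ω + τ ω ∈ Set.uIcc (f ω) c) :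
    IsLevelContraction μ f ⇑(f + τ) := by
  have hadd := Lp.coeFn_add f τ
  refine ⟨?_, c, ?_⟩
  · rw [integral_congr_ae hadd, integral_add' ((Lp.memLp f).integrable hp.out)
      ((Lp.memLp τ).integrable hp.out), hmean, add_zero]
  · filter_upwards [hadd, hmem] with ω hω hmemω
    rwa [hω]

lemma exists_balanced_exchange {p : ℝ≥0∞} [hp : Fact (1 ≤ p)] {f g : Lp ℝ p μ} {c d : ℝ}
    (hdown : ∃ᵐ ω ∂μ, c < f ω ∧ g ω < d) (hup : ∃ᵐ ω ∂μ, d < g ω ∧ f ω < c) :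
    ∃ τ : Lp ℝ p μ, τ ≠ 0 ∧ IsLevelContraction μ f ⇑(f + τ) ∧
      IsLevelContraction μ g ⇑(g - τ) := by
  set a : Ω → ℝ := fun ω => transferable c d (f ω) (g ω)
  set b : Ω → ℝ := fun ω => transferable d c (g ω) (f ω)
  have ha : MemLp a p μ := memLp_transferable (Lp.memLp f) (Lp.aestronglyMeasurable g) c d
  have hb : MemLp b p μ := memLp_transferable (Lp.memLp g) (Lp.aestronglyMeasurable f) d c
  have ha_pos : 0 < ∫ ω, a ω ∂μ := integral_transferable_pos (ha.integrable hp.out) hdown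
  have hb_pos : 0 < ∫ ω, b ω ∂μ := integral_transferable_pos (hb.integrable hp.out) hup
  obtain ⟨s, hs, t, ht, hbalance⟩ := exists_balancing_weights ha_pos hb_pos
  have hτ : MemLp (fun ω => t * b ω - s * a ω) p μ := (hb.const_mul t).sub (ha.const_mul s)
  have hcoe := hτ.coeFn_toLp
  have hneg := Lp.coeFn_neg (hτ.toLp _)
  have hmean : ∫ ω, hτ.toLp _ ω ∂μ = 0 := by
    rw [integral_congr_ae hcoe, integral_sub ((hb.integrable hp.out).const_mul t)
      ((ha.integrable hp.out).const_mul s), integral_const_mul, integral_const_mul]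
    exact sub_eq_zero.2 hbalance
  refine ⟨hτ.toLp, fun hzero => ?_, isLevelContraction_add (c := c) hmean ?_,
    sub_eq_add_neg g (hτ.toLp _) ▸ isLevelContraction_add (c := d) ?_ ?_⟩
  · have hae := hcoe.symm.trans (Lp.eq_zero_iff_ae_eq_zero.1 hzero)
    obtain ⟨ω, hω, hω₀⟩ := (hdown.and_eventually hae).exists
    have haω : 0 < a ω := transferable_pos_iff.2 hω
    have hbω : b ω = 0 := (transferable_eq_zero_or _ _ _ _).resolve_left haω.ne'
    simp only [hbω, mul_zero, zero_sub, Pi.zero_apply, neg_eq_zero] at hω₀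
    exact (mul_pos hs.1 haω).ne' hω₀
  · filter_upwards [hcoe] with ω hω
    rw [hω]
    exact add_transferable_sub_mem_uIcc _ _ _ _ (Set.Ioc_subset_Icc_self hs) ht
  · rw [integral_congr_ae hneg, integral_neg', hmean, neg_zero]
  · filter_upwards [hcoe, hneg] with ω hω hnegω
    rw [hnegω, Pi.neg_apply, hω, neg_sub]
    exact add_transferable_sub_mem_uIcc _ _ _ _ ht (Set.Ioc_subset_Icc_self hs)

variable {ι : Type*} [Fintype ι]

/-- The square-integrable redistributions of the aggregate of `y` each of whose components dominates
the corresponding component of `y` in the concave order. They are encoded in the `ℓ²`-sum of copies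
of `L²`, the Hilbert space in which an element of least norm is sought. -/
def concaveImprovements (y : ι → Lp ℝ 2 μ) : Set (PiLp 2 fun _ : ι => Lp ℝ 2 μ) :=
  {z | ∑ i, z i = ∑ i, y i ∧ ∀ i, ConcaveLE μ (y i) (z i)}

lemma exists_norm_le_of_isComplete_convex {H : Type*} [NormedAddCommGroup H]
    [InnerProductSpace ℝ H] {K : Set H} (hne : K.Nonempty) (hcomplete : IsComplete K)
    (hconvex : Convex ℝ K) : ∃ v ∈ K, ∀ w ∈ K, ‖v‖ ≤ ‖w‖ := by
  obtain ⟨v, hv, hmin⟩ := exists_norm_eq_iInf_of_complete_convex hne hcomplete hconvex 0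
  refine ⟨v, hv, fun w hw => ?_⟩
  simp only [zero_sub, norm_neg] at hmin
  rw [hmin]
  exact ciInf_le ⟨0, Set.forall_mem_range.2 fun _ => norm_nonneg _⟩ (⟨w, hw⟩ : K)

variable {y : ι → Lp ℝ 2 μ}

lemma exists_minimal_concaveImprovement (hy : ∀ i, MemLp (y i) ⊤ μ) :
    ∃ z ∈ concaveImprovements y, ∀ w ∈ concaveImprovements y, ‖z‖ ≤ ‖w‖ := by
  have hset : concaveImprovements y =
      {z | ∑ i, z i = ∑ i, y i} ∩ ⋂ i, {z | ConcaveLE μ (y i) (z i)} := by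
    ext z
    simp [concaveImprovements]
  have hclosed : IsClosed (concaveImprovements y) := by
    rw [hset]
    refine (isClosed_eq (by fun_prop) continuous_const).inter (isClosed_iInter fun i => ?_)
    exact (isClosed_setOf_concaveLE (hy i)).preimage
      (PiLp.continuous_apply 2 (fun _ : ι => Lp ℝ 2 μ) i)
  have hconvex : Convex ℝ (concaveImprovements y) := by
    rintro z ⟨hzsum, hz⟩ w ⟨hwsum, hw⟩ a b ha hb hab
    refine ⟨?_, fun i => convex_setOf_concaveLE (hy i) (hz i) (hw i) ha hb hab⟩
    simp only [PiLp.add_apply, PiLp.smul_apply, Finset.sum_add_distrib, ← Finset.smul_sum, hzsum,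
      hwsum, ← add_smul, hab, one_smul]
  exact exists_norm_le_of_isComplete_convex
    ⟨WithLp.toLp 2 y, rfl, fun i => concaveLE_of_ae_eq EventuallyEq.rfl⟩ hclosed.isComplete hconvex

lemma eq_of_isLevelContraction_of_minimal (hy : ∀ i, MemLp (y i) ⊤ μ)
    {z w : PiLp 2 fun _ : ι => Lp ℝ 2 μ} (hz : z ∈ concaveImprovements y)
    (hmin : ∀ w ∈ concaveImprovements y, ‖z‖ ≤ ‖w‖) (hsum : ∑ i, w i = ∑ i, z i)
    (hw : ∀ i, IsLevelContraction μ (z i) (w i)) : w = z := by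
  have hw_mem : w ∈ concaveImprovements y := by
    refine ⟨hsum.trans hz.1, fun i => (hz.2 i).trans ?_⟩
    have hzi : MemLp (z i) ⊤ μ :=
      (hz.2 i).memLp_top (hy i) ((Lp.memLp (z i)).integrable one_le_two)
    exact (hw i).concaveLE hzi (Lp.aestronglyMeasurable _)
  have hsq : ‖w‖ ^ 2 + ‖w - z‖ ^ 2 ≤ ‖z‖ ^ 2 := by
    simp only [PiLp.norm_sq_eq_of_L2, ← Finset.sum_add_distrib]
    exact Finset.sum_le_sum fun i _ => (hw i).norm_sq_add_norm_sub_sq_le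
  have hzw : ‖z‖ ^ 2 ≤ ‖w‖ ^ 2 := pow_le_pow_left₀ (norm_nonneg _) (hmin w hw_mem) 2
  have hzero : ‖w - z‖ ^ 2 = 0 := le_antisymm (by linarith) (sq_nonneg _)
  exact sub_eq_zero.1 (norm_eq_zero.1 (sq_eq_zero_iff.1 hzero))

lemma not_frequently_opposed_of_minimal (hy : ∀ i, MemLp (y i) ⊤ μ)
    {z : PiLp 2 fun _ : ι => Lp ℝ 2 μ} (hz : z ∈ concaveImprovements y)
    (hmin : ∀ w ∈ concaveImprovements y, ‖z‖ ≤ ‖w‖) {i j : ι} {c d : ℝ}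
    (hdown : ∃ᵐ ω ∂μ, c < z i ω ∧ z j ω < d) : ¬ ∃ᵐ ω ∂μ, d < z j ω ∧ z i ω < c := by
  classical
  intro hup
  have hij : i ≠ j := by
    rintro rfl
    obtain ⟨ω₁, h₁⟩ := hdown.exists
    obtain ⟨ω₂, h₂⟩ := hup.exists
    exact lt_asymm (h₁.1.trans h₁.2) (h₂.1.trans h₂.2)
  obtain ⟨τ, hτ, hτi, hτj⟩ := exists_balanced_exchange hdown hup
  let w : PiLp 2 fun _ : ι => Lp ℝ 2 μ := z + PiLp.single 2 i τ - PiLp.single 2 j τ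
  have hwi : w i = z i + τ := by simp [w, hij]
  have hwj : w j = z j - τ := by simp [w, hij.symm]
  have hwk : ∀ k, k ≠ i → k ≠ j → w k = z k := fun k hki hkj => by simp [w, hki, hkj]
  have hsum : ∑ k, w k = ∑ k, z k := by
    simp [w, Finset.sum_add_distrib, Finset.sum_sub_distrib]
  have hw : ∀ k, IsLevelContraction μ (z k) (w k) := fun k => by
    by_cases hki : k = i
    · rwa [hki, hwi]
    by_cases hkj : k = j
    · rwa [hkj, hwj]
    rw [hwk k hki hkj]
    exact .refl _
  have hwz : w = z := eq_of_isLevelContraction_of_minimal hy hz hmin hsum hw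
  exact hτ (by simpa [hwz] using hwi)

lemma exists_monovary_concaveLE (hy : ∀ i, MemLp (y i) ⊤ μ) :
    ∃ z : ι → Lp ℝ 2 μ, ∃ Z : ι → Ω → ℝ, ∑ i, z i = ∑ i, y i ∧ (∀ i, ConcaveLE μ (y i) (z i)) ∧
      (∀ i, Measurable (Z i)) ∧ (∀ i, z i =ᵐ[μ] Z i) ∧ ∀ i j, Monovary (Z i) (Z j) := by
  obtain ⟨z, hz, hmin⟩ := exists_minimal_concaveImprovement hy
  obtain ⟨Z, hZ⟩ := exists_measurable_monovary_versions (μ := μ)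
    (fun i => (Lp.stronglyMeasurable (z i)).measurable)
    fun i j => exists_mem_ae_monovaryOn fun _ _ => not_frequently_opposed_of_minimal hy hz hmin
  exact ⟨z, Z, hz.1, hz.2, hZ⟩

end Improvement

section Allocations

variable {Ω : Type*} [MeasurableSpace Ω] {μ : Measure Ω} {n : ℕ}

lemma coeFn_sum_congr_ae {ι : Type*} [Fintype ι] {p q : ℝ≥0∞} {f : ι → Lp ℝ p μ}
    {g : ι → Lp ℝ q μ} (h : ∀ i, f i =ᵐ[μ] g i) : ⇑(∑ i, f i) =ᵐ[μ] ⇑(∑ i, g i) := by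
  filter_upwards [Lp.coeFn_finsetSum Finset.univ f, Lp.coeFn_finsetSum Finset.univ g,
    ae_all_iff.2 h] with ω hf hg hfg
  simp only [hf, hg, Finset.sum_apply, hfg]

theorem exists_comonotone_improvement [IsFiniteMeasure μ] (Y : Fin n → LInfty μ) :
    ∃ Z : Fin n → LInfty μ, ∑ i, Z i = ∑ i, Y i ∧ Comonotone Z ∧ ∀ i, ICVLe μ (Y i) (Z i) := by
  have hY₂ : ∀ i, MemLp (Y i) 2 μ := fun i => (Lp.memLp (Y i)).mono_exponent le_top
  have hY : ∀ i, (hY₂ i).toLp =ᵐ[μ] Y i := fun i => (hY₂ i).coeFn_toLp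
  have hy : ∀ i, MemLp (hY₂ i).toLp ⊤ μ := fun i => (Lp.memLp (Y i)).ae_eq (hY i).symm
  obtain ⟨z, V, hsum, hle, hV_meas, hzV, hV⟩ := exists_monovary_concaveLE hy
  have hz : ∀ i, MemLp (z i) ⊤ μ := fun i =>
    (hle i).memLp_top (hy i) ((Lp.memLp (z i)).integrable one_le_two)
  have hZ : ∀ i, (hz i).toLp =ᵐ[μ] z i := fun i => (hz i).coeFn_toLp
  refine ⟨fun i => (hz i).toLp, ?_, ⟨V, hV_meas, fun i => (hZ i).trans (hzV i),
    fun ω₁ ω₂ i j => ?_⟩, fun i => ConcaveLE.icvLe ?_⟩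
  · have hz_sum := coeFn_sum_congr_ae hZ
    rw [hsum] at hz_sum
    exact Lp.ext (hz_sum.trans (coeFn_sum_congr_ae hY))
  · exact monovary_iff_forall_mul_nonneg.1 (hV i j) ω₂ ω₁
  · exact ((concaveLE_of_ae_eq (hY i).symm).trans (hle i)).trans (concaveLE_of_ae_eq (hZ i).symm)

variable {X : Fin n → LInfty μ} {U : Fin n → LInfty μ → ℝ}

lemma Dominates.of_le {Y₁ Y₂ Z₁ Z₂ : Fin n → LInfty μ} (h : Dominates U Y₂ Y₁)
    (h₁ : ∀ i, U i (Z₁ i) ≤ U i (Y₁ i)) (h₂ : ∀ i, U i (Y₂ i) ≤ U i (Z₂ i)) :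
    Dominates U Z₂ Z₁ :=
  ⟨fun i => (h₁ i).trans ((h.1 i).trans (h₂ i)),
    h.2.imp fun i hi => (h₁ i).trans_lt (hi.trans_le (h₂ i))⟩

variable [IsFiniteMeasure μ]

lemma exists_comonotone_IR_improvement (hssd : ∀ i, SSDPreserving μ (U i))
    {Y : Fin n → LInfty μ} (hY : Y ∈ IR U X) :
    ∃ Z ∈ IR U X ∩ comonotoneAllocations X, ∀ i, U i (Y i) ≤ U i (Z i) := by
  obtain ⟨Z, hsum, hcom, hle⟩ := exists_comonotone_improvement Y
  have hZ : Z ∈ allocations X := hsum.trans hY.1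
  have hU : ∀ i, U i (Y i) ≤ U i (Z i) := fun i => hssd i _ _ (hle i)
  exact ⟨Z, ⟨⟨hZ, fun i => (hY.2 i).trans (hU i)⟩, hZ, hcom⟩, hU⟩

theorem PO_nonempty_iff_CPO_nonempty (hssd : ∀ i, SSDPreserving μ (U i)) :
    (PO U X).Nonempty ↔ (CPO U X).Nonempty := by
  constructor
  · rintro ⟨Y, hY, hopt⟩
    obtain ⟨Z, hZ, hYZ⟩ := exists_comonotone_IR_improvement hssd hY
    exact ⟨Z, hZ, fun ⟨W, hW, hdom⟩ => hopt ⟨W, hW.1, hdom.of_le hYZ fun _ => le_rfl⟩⟩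
  · rintro ⟨Y, hY, hopt⟩
    refine ⟨Y, hY.1, fun ⟨W, hW, hdom⟩ => ?_⟩
    obtain ⟨Z, hZ, hWZ⟩ := exists_comonotone_IR_improvement hssd hW
    exact hopt ⟨Z, hZ, hdom.of_le (fun _ => le_rfl) hWZ⟩

theorem weightedSup_IR_eq (hssd : ∀ i, SSDPreserving μ (U i)) {l : Fin n → ℝ}
    (hl : ∀ i, 0 ≤ l i) :
    weightedSup U l (IR U X) = weightedSup U l (IR U X ∩ comonotoneAllocations X) := by
  refine le_antisymm (iSup₂_le fun Y hY => ?_) (biSup_mono fun Y hY => hY.1)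
  obtain ⟨Z, hZ, hYZ⟩ := exists_comonotone_IR_improvement hssd hY
  refine le_iSup₂_of_le Z hZ (EReal.coe_le_coe_iff.2 ?_)
  exact Finset.sum_le_sum fun i _ => mul_le_mul_of_nonneg_left (hYZ i) (hl i)

end Allocations

end RiskSharing

theorem theorem3p8_general {Ω : Type*} [MeasurableSpace Ω] (μ : Measure Ω) [IsFiniteMeasure μ]
    (n : ℕ) (X : Fin n → RiskSharing.LInfty μ) (U : Fin n → RiskSharing.LInfty μ → ℝ)
    (hssd : ∀ i, RiskSharing.SSDPreserving μ (U i)) :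
    ((RiskSharing.PO U X).Nonempty ↔ (RiskSharing.CPO U X).Nonempty) ∧
    ∀ l : Fin n → ℝ, (∀ i, 0 ≤ l i) →
      RiskSharing.weightedSup U l (RiskSharing.IR U X) =
        RiskSharing.weightedSup U l (RiskSharing.IR U X ∩ RiskSharing.comonotoneAllocations X) :=
  ⟨RiskSharing.PO_nonempty_iff_CPO_nonempty hssd,
    fun _ hl => RiskSharing.weightedSup_IR_eq hssd hl⟩

theorem theorem3p8 {Ω : Type*} [MeasurableSpace Ω] (μ : Measure Ω) [IsProbabilityMeasure μ]
    (hμ : RiskSharing.Atomless μ) (n : ℕ)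
    (X : Fin n → RiskSharing.LInfty μ) (U : Fin n → RiskSharing.LInfty μ → ℝ)
    (hconc : ∀ i, ConcaveOn ℝ Set.univ (U i))
    (hssd : ∀ i, RiskSharing.SSDPreserving μ (U i))
    (hcash : ∀ i, RiskSharing.IncreasingInCash μ (U i)) :
    ((RiskSharing.PO U X).Nonempty ↔ (RiskSharing.CPO U X).Nonempty) ∧
    ((RiskSharing.PO U X).Nonempty → (RiskSharing.CPO U X).Nonempty →
      ∀ l ∈ RiskSharing.weights n,
        RiskSharing.weightedSup U l (RiskSharing.IR U X) =
          RiskSharing.weightedSup U l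
            (RiskSharing.IR U X ∩ RiskSharing.comonotoneAllocations X)) :=
  (theorem3p8_general μ n X U hssd).imp_right fun h _ _ l hl => h l hl.1
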